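/- Let $T\ge 1$, let $\mathcal X_1,\dots,\mathcal X_T$ be Polish spaces with their Borel $\sigma$-algebras, and let $\mathcal X=\prod_{t=1}^T\mathcal X_t$ with the product topology. For $x=(x_1,\dots,x_T)\in\mathcal X$ write $x_{1:t}=(x_1,\dots,x_t)$. Let $\mu,\nu$ be Borel probability measures on $\mathcal X$. A Borel probability measure $\pi$ on $\mathcal X\times\mathcal X$ is a *bicausal coupling* of $\mu$ and $\nu$ if its first and second marginals are $\mu$ and $\nu$ and, for $(X,Y)\sim\pi$ and every $t\in\{1,\dots,T-1\}$, under $\pi$, $Y_{1:t}$ is conditionally independent of $X$ given $X_{1:t}$, and $X_{1:t}$ is conditionally independent of $Y$ given $Y_{1:t}$. Let $\mathrm{Cpl}_{\mathrm{bc}}(\mu,\nu)$ be the set of bicausal couplings. For Borel measurable $\varphi:\mathcal X\to[0,\infty)$ define the adapted weighted total variation $$\mathrm{ATV}_\varphi(\mu,\nu)=\inf_{\pi\in\mathrm{Cpl}_{\mathrm{bc}}(\mu,\nu)}\int_{\mathcal X\times\mathcal X}\bigl(\varphi(x)+\varphi(y)\bigr)\mathbf 1_{\{x\ne y\}}\,\pi(dx,dy)\in[0,\infty],$$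 and let $H(\nu|\mu)=\int\log\frac{d\nu}{d\mu}\,d\nu$ if $\nu\ll\mu$ and $H(\nu|\mu)=+\infty$ otherwise. **Theorem.** For all Borel probability measures $\mu,\nu$ on $\mathcal X$ and every Borel measurable $\varphi:\mathcal X\to[0,\infty)$, $$\mathrm{ATV}_\varphi(\mu,\nu)\le(2\sqrt T+1)\left(1+\log\int_{\mathcal X}e^{\varphi(x)^2}\,\mu(dx)\right)^{1/2}\sqrt{2H(\nu|\mu)},$$ where both sides take values in $[0,\infty]$, with $\log\infty=\infty$ and $0\cdot\infty=0$. -/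

import Mathlib

open MeasureTheory ProbabilityTheory InformationTheory
open scoped ENNReal NNReal

namespace AdaptedTransport

universe u

/-- The first `t` coordinates of a path `x` with `T` time steps. Time is indexed by `Fin T`, so the
coordinates kept are those whose index is `0, …, t - 1`. -/
def initSegment {T : ℕ} {X : Fin T → Type u} (t : ℕ) (x : ∀ i, X i) :
    ∀ i : {i : Fin T // (i : ℕ) < t}, X i :=
  fun i => x i

lemma measurable_initSegment {T : ℕ} {X : Fin T → Type u} [∀ i, MeasurableSpace (X i)] (t : ℕ) :
    Measurable (initSegment (X := X) t) :=
  measurable_pi_lambda _ fun i => measurable_pi_apply i.1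

/-- `π` is a bicausal coupling of `μ` and `ν`: it has marginals `μ` and `ν`, and for `(X, Y) ∼ π`
and `1 ≤ t ≤ T - 1`, the segment `Y_{1:t}` is conditionally independent of the whole path `X` given
`X_{1:t}`, and the segment `X_{1:t}` is conditionally independent of the whole path `Y` given
`Y_{1:t}`. -/
structure IsBicausalCoupling {T : ℕ} {X : Fin T → Type u} [∀ i, MeasurableSpace (X i)]
    [∀ i, StandardBorelSpace (X i)]
    (π : Measure ((∀ i, X i) × (∀ i, X i))) [IsProbabilityMeasure π]
    (μ ν : Measure (∀ i, X i)) : Prop where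
  map_fst : π.map Prod.fst = μ
  map_snd : π.map Prod.snd = ν
  causal : ∀ t : ℕ, 1 ≤ t → t < T →
    (fun p : (∀ i, X i) × (∀ i, X i) => initSegment (X := X) t p.2)
      ⟂ᵢ[fun p : (∀ i, X i) × (∀ i, X i) => initSegment (X := X) t p.1,
        (measurable_initSegment t).comp measurable_fst; π]
    (fun p : (∀ i, X i) × (∀ i, X i) => p.1)
  anticausal : ∀ t : ℕ, 1 ≤ t → t < T →
    (fun p : (∀ i, X i) × (∀ i, X i) => initSegment (X := X) t p.1)
      ⟂ᵢ[fun p : (∀ i, X i) × (∀ i, X i) => initSegment (X := X) t p.2,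
        (measurable_initSegment t).comp measurable_snd; π]
    (fun p : (∀ i, X i) × (∀ i, X i) => p.2)

/-- The adapted weighted total variation: the infimum over all bicausal couplings `π` of
`∫ (φ x + φ y) 1_{x ≠ y} π(dx, dy)`, as an extended nonnegative number. -/
noncomputable def adaptedTV {T : ℕ} {X : Fin T → Type u} [∀ i, MeasurableSpace (X i)]
    [∀ i, StandardBorelSpace (X i)]
    (φ : (∀ i, X i) → ℝ≥0) (μ ν : Measure (∀ i, X i)) : ℝ≥0∞ :=
  ⨅ (π : ProbabilityMeasure ((∀ i, X i) × (∀ i, X i)))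
    (_ : IsBicausalCoupling (π : Measure ((∀ i, X i) × (∀ i, X i))) μ ν),
    ∫⁻ p, {p : (∀ i, X i) × (∀ i, X i) | p.1 ≠ p.2}.indicator
      (fun p => (φ p.1 : ℝ≥0∞) + (φ p.2 : ℝ≥0∞)) p ∂(π : Measure ((∀ i, X i) × (∀ i, X i)))

end AdaptedTransport

/-! When `H(ν|μ)` is finite, let `ℓ t` be the density of `ν` with respect to `μ` on the σ-algebra `F
t` of the first `t` coordinates. The coupling keeps as much mass as it can on the diagonal, one time
step at a time: `v t = keptWeight ℓ t` is the fraction of `ν` still coupled at time `t`, and `u t =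
v t * ℓ t` that of `μ`. Both decrease in `t`, and `u t • μ` and `v t • ν` agree on `F t`. The masses
lost between `t` and `t + 1` therefore agree on `F t`, and are glued along it: the two paths share
their first `t` coordinates and are conditionally independent given them. The sum of these pieces
and the diagonal part is bicausal (`exists_bicausal_splitCoupling`), because the losses up to time
`s` depend on the past up to `s` only.

Its cost is at most `∫ φ (1 - u T) dμ + ∫ φ (1 - v T) dν`, to which Cauchy–Schwarz is applied.
Gibbs' variational inequality (`lintegral_sq_mul_le`) bounds the second moments of `φ` by `log ∫ exp
(φ ^ 2) dμ` under `μ`, and by this plus `H` under `ν`. For the other factors, `1 - u T` is a sum of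
`T` losses; the square of each loss is dominated by twice the conditional entropy of that step
(`sq_keptWeight_mul_sub_le`, `mul_sq_keptWeight_sub_le`), and the chain rule
(`sum_lintegral_klFun_div_le`) bounds the total by `2 * T * H`. The same holds for `v`. For `H ≥ 1`
the trivial bounds `1 - u T ≤ 1` and `1 - v T ≤ 1` are used instead. -/

namespace AdaptedTransport

/-! ### Conditionally independent gluing along a sub-σ-algebra -/

section Gluing

variable {E : Type*} {m mE : MeasurableSpace E} [StandardBorelSpace E]

lemma lintegral_condExpKernel_mul {α : Measure E} [IsFiniteMeasure α]
    (hm : m ≤ mE) {A : Set E} (hA : MeasurableSet A) {g : E → ℝ≥0∞} (hg : Measurable[m] g) :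
    ∫⁻ x, g x * condExpKernel α m x A ∂α = ∫⁻ x in A, g x ∂α := by
  have hF : Measurable[m.prod mE] fun p : E × E => g p.1 * A.indicator 1 p.2 :=
    (hg.comp (@measurable_fst E E m mE)).mul
      ((measurable_one.indicator hA).comp (@measurable_snd E E m mE))
  have hd : @Measurable E (E × E) mE (m.prod mE) Function.diag :=
    Measurable.prodMk (measurable_id'' hm) measurable_id
  have h := congrArg (fun ρ => @lintegral (E × E) (m.prod mE) ρ fun p => g p.1 * A.indicator 1 p.2)
    (compProd_trim_condExpKernel (μ := α) hm)
  rw [@Measure.lintegral_compProd E E m mE _ _ _ _ _ hF,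
    @lintegral_map E (E × E) mE (m.prod mE) _ _ _ hF hd] at h
  have h1 : ∀ x, ∫⁻ y, g x * A.indicator 1 y ∂(condExpKernel α m x)
      = g x * condExpKernel α m x A := by
    intro x
    rw [lintegral_const_mul _ (measurable_one.indicator hA), lintegral_indicator_one hA]
  simp only [h1] at h
  rw [lintegral_trim hm (f := fun x => g x * condExpKernel α m x A)
    (hg.mul (measurable_condExpKernel hA))] at h
  rw [h, ← lintegral_indicator hA]
  refine lintegral_congr fun x => ?_
  by_cases hx : x ∈ A <;> simp [Function.diag, hx]

/-- The one-sided part of the statement that `ρ` couples `α` with another measure so that the two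
coordinates are conditionally independent given, and agree on, the `σ`-algebra `m`. -/
structure IsGluedLeft {E : Type*} (m : MeasurableSpace E) {mE : MeasurableSpace E}
    (α : Measure E) (ρ : Measure (E × E)) : Prop where
  exists_density : ∀ B, MeasurableSet B → ∃ g : E → ℝ≥0∞, Measurable[m] g ∧
    ∀ A, MeasurableSet A → ρ (A ×ˢ B) = ∫⁻ x in A, g x ∂α
  inter : ∀ A B, MeasurableSet A → MeasurableSet[m] B → ρ (A ×ˢ B) = α (A ∩ B)

/-- Two finite measures that agree on `m` can be glued along `m`. -/
lemma exists_glued (hm : m ≤ mE) (α β : Measure E) [IsFiniteMeasure α]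
    [IsFiniteMeasure β] (h : ∀ A, MeasurableSet[m] A → α A = β A) :
    ∃ ρ : Measure (E × E), IsGluedLeft m α ρ ∧ IsGluedLeft m β (ρ.map Prod.swap) := by
  have htrim : α.trim hm = β.trim hm := by
    refine @Measure.ext _ m _ _ fun A hA => ?_
    rw [trim_measurableSet_eq hm hA, trim_measurableSet_eq hm hA, h A hA]
  have hlint : ∀ g : E → ℝ≥0∞, Measurable[m] g → ∫⁻ x, g x ∂α = ∫⁻ x, g x ∂β := by
    intro g hg
    rw [← lintegral_trim hm hg, htrim, lintegral_trim hm hg]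
  let κ : Kernel E E := (condExpKernel β m).comap id (measurable_id'' hm)
  have hρ : ∀ A B, MeasurableSet A → MeasurableSet B →
      (α ⊗ₘ κ) (A ×ˢ B) = ∫⁻ x in A, condExpKernel β m x B ∂α := by
    intro A B hA hB
    rw [Measure.compProd_apply_prod hA hB]
    rfl
  have hswap : ∀ A B, MeasurableSet A → MeasurableSet B →
      ((α ⊗ₘ κ).map Prod.swap) (B ×ˢ A) = (α ⊗ₘ κ) (A ×ˢ B) := by
    intro A B hA hB
    rw [Measure.map_apply measurable_swap (hB.prod hA), Set.preimage_swap_prod]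
  refine ⟨α ⊗ₘ κ, ⟨fun B hB => ⟨fun x => condExpKernel β m x B, measurable_condExpKernel hB,
    fun A hA => hρ A B hA hB⟩, ?_⟩, ⟨fun A hA => ⟨fun x => condExpKernel α m x A,
      measurable_condExpKernel hA, fun B hB => ?_⟩, ?_⟩⟩
  · intro A B hA hB
    rw [hρ A B hA (hm _ hB)]
    -- The identity holds up to null sets of the trace of `β` on `m`, which is also the trace of
    -- `α`.
    have h1 : (fun x => condExpKernel β m x B) =ᵐ[α] B.indicator 1 := by
      refine ae_eq_of_ae_eq_trim (hm := hm) ?_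
      rw [htrim]
      filter_upwards [condExpKernel_ae_eq_trim_condExp (μ := β) hm (hm _ hB)] with x hx
      have hBm : StronglyMeasurable[m] (B.indicator fun _ => (1 : ℝ)) :=
        StronglyMeasurable.indicator stronglyMeasurable_const hB
      rw [condExp_of_stronglyMeasurable hm hBm
        ((integrable_const _).indicator (hm _ hB))] at hx
      have hfin : condExpKernel β m x B ≠ ∞ := measure_ne_top _ _
      rw [← ENNReal.ofReal_toReal hfin]
      change ENNReal.ofReal ((condExpKernel β m x).real B) = _
      rw [hx]
      by_cases hxB : x ∈ B <;> simp [hxB]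
    rw [lintegral_congr_ae (ae_restrict_of_ae h1), lintegral_indicator_one (hm _ hB),
      Measure.restrict_apply (hm _ hB), Set.inter_comm]
  -- The mass of `A ×ˢ B` is the integral of the product of the two conditional probabilities. This
  -- product is `m`-measurable, so `α` may be replaced by `β`, and the formula is symmetric.
  · rw [hswap A B hA hB, hρ A B hA hB, ← lintegral_condExpKernel_mul hm hA
      (measurable_condExpKernel hB), hlint (fun x => condExpKernel β m x B * condExpKernel α m x A)
        ((measurable_condExpKernel hB).mul (measurable_condExpKernel hA)),
      ← lintegral_condExpKernel_mul hm hB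
      (measurable_condExpKernel hA)]
    simp_rw [mul_comm]
  · intro B A hB hA
    rw [hswap A B (hm _ hA) hB, hρ A B (hm _ hA) hB]
    have h1 : ∀ γ : Measure E, ∫⁻ x in A, condExpKernel β m x B ∂γ
        = ∫⁻ x, A.indicator 1 x * condExpKernel β m x B ∂γ := by
      intro γ
      rw [← lintegral_indicator (hm _ hA)]
      refine lintegral_congr fun x => ?_
      by_cases hx : x ∈ A <;> simp [hx]
    have hone : Measurable[m] (1 : E → ℝ≥0∞) := measurable_const
    have hAm : Measurable[m] (A.indicator (1 : E → ℝ≥0∞)) := Measurable.indicator hone hA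
    rw [h1, hlint (fun x => A.indicator 1 x * condExpKernel β m x B)
      (hAm.mul (measurable_condExpKernel hB)), lintegral_condExpKernel_mul hm hB hAm,
      lintegral_indicator_one (hm _ hA), Measure.restrict_apply (hm _ hA), Set.inter_comm]

end Gluing

/-! ### Conditional independence from measurable densities -/

section CondIndep

/-- `G` is a version of the probability of `S` given `m1`. Being `m0`-measurable, it is also one
given `m0`; the product formula follows by the tower property and by pulling `G` out. -/
lemma condExp_inter_ae_eq_mul {Ω : Type*} {m0 m1 mΩ : MeasurableSpace Ω} {P : Measure Ω}
    [IsProbabilityMeasure P] (hm01 : m0 ≤ m1) (hm1 : m1 ≤ mΩ) {S : Set Ω} (hS : MeasurableSet S)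
    {G : Ω → ℝ} (hGm : StronglyMeasurable[m0] G) (hGint : Integrable G P)
    (hG : ∀ s, MeasurableSet[m1] s → ∫ ω in s, G ω ∂P = P.real (s ∩ S)) {s : Set Ω}
    (hs : MeasurableSet[m1] s) :
    P⟦s ∩ S | m0⟧ =ᵐ[P] fun ω => (P⟦s | m0⟧) ω * (P⟦S | m0⟧) ω := by
  have hS1 : P⟦S | m1⟧ =ᵐ[P] G := by
    refine (ae_eq_condExp_of_forall_setIntegral_eq hm1
      ((integrable_const _).indicator hS) (fun s _ _ => hGint.integrableOn) ?_
      (hGm.mono hm01).aestronglyMeasurable).symm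
    intro s hs _
    rw [hG s hs, setIntegral_indicator hS]
    simp
  have hS0 : P⟦S | m0⟧ =ᵐ[P] G := by
    refine (condExp_condExp_of_le hm01 hm1).symm.trans ?_
    refine (condExp_congr_ae hS1).trans ?_
    rw [condExp_of_stronglyMeasurable (hm01.trans hm1) hGm hGint]
  have hsint : Integrable (s.indicator fun _ => (1 : ℝ)) P :=
    (integrable_const _).indicator (hm1 _ hs)
  have hmulint : Integrable (G * s.indicator fun _ => (1 : ℝ)) P := by
    refine (hGint.indicator (hm1 _ hs)).congr (Filter.Eventually.of_forall fun ω => ?_)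
    by_cases hω : ω ∈ s <;> simp [hω]
  have h1 : P⟦s ∩ S | m1⟧ =ᵐ[P] G * s.indicator fun _ => (1 : ℝ) := by
    rw [← Set.indicator_indicator]
    refine (condExp_indicator ((integrable_const _).indicator hS) hs).trans ?_
    filter_upwards [hS1] with ω hω
    by_cases h : ω ∈ s
    · simp [h, hω]
    · simp [h]
  have h0 : P⟦s ∩ S | m0⟧ =ᵐ[P] G * P⟦s | m0⟧ := by
    refine (condExp_condExp_of_le hm01 hm1).symm.trans ?_
    refine (condExp_congr_ae h1).trans ?_
    exact condExp_mul_of_stronglyMeasurable_left hGm hmulint hsint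
  filter_upwards [h0, hS0] with ω hω hω'
  rw [hω, hω', Pi.mul_apply, mul_comm]

lemma condIndepFun_of_forall_exists_density {Ω E γ : Type*} {mΩ : MeasurableSpace Ω}
    [StandardBorelSpace Ω] [MeasurableSpace E] [MeasurableSpace γ] {P : Measure Ω}
    [IsProbabilityMeasure P] {X Y : Ω → E} (hX : Measurable X) (hY : Measurable Y) {f : E → γ}
    (hf : Measurable f)
    (h : ∀ B, MeasurableSet B → ∃ g : γ → ℝ≥0∞, Measurable g ∧ ∀ A, MeasurableSet A →
      P (X ⁻¹' A ∩ Y ⁻¹' (f ⁻¹' B)) = ∫⁻ ω in X ⁻¹' A, g (f (X ω)) ∂P) :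
    (fun ω => f (Y ω)) ⟂ᵢ[fun ω => f (X ω), hf.comp hX; P] X := by
  refine CondIndepFun.symm ((condIndepFun_iff_condExp_inter_preimage_eq_mul hX (hf.comp hY)).2 ?_)
  intro A B hA hB
  obtain ⟨g, hg, hgA⟩ := h B hB
  have hG : Measurable fun ω => g (f (X ω)) := hg.comp (hf.comp hX)
  have hfin : ∫⁻ ω, g (f (X ω)) ∂P ≠ ∞ := by
    have := hgA Set.univ MeasurableSet.univ
    simp only [Set.preimage_univ, Set.univ_inter, Measure.restrict_univ] at this
    rw [← this]
    exact measure_ne_top _ _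
  have hm01 : MeasurableSpace.comap (fun ω => f (X ω)) inferInstance
      ≤ MeasurableSpace.comap X inferInstance := by
    rw [show (fun ω => f (X ω)) = f ∘ X from rfl, ← MeasurableSpace.comap_comp]
    exact MeasurableSpace.comap_mono hf.comap_le
  refine condExp_inter_ae_eq_mul hm01 hX.comap_le (hY (hf hB))
    (G := fun ω => (g (f (X ω))).toReal) ?_
    (integrable_toReal_of_lintegral_ne_top hG.aemeasurable hfin) ?_ ⟨A, hA, rfl⟩
  · exact (hg.ennreal_toReal.comp (comap_measurable fun ω => f (X ω))).stronglyMeasurable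
  · rintro s ⟨A, hA, rfl⟩
    rw [integral_toReal hG.aemeasurable.restrict
      (ae_restrict_of_ae (ae_lt_top' hG.aemeasurable hfin)), ← hgA A hA]
    rfl

end CondIndep

/-! ### The coupling assembled from the losses of each step -/

section Mixture

variable {E : Type*} {mE : MeasurableSpace E}

lemma sum_Ico_tsub_add {u : ℕ → ℝ≥0} (hu : Antitone u) {s T : ℕ} (h : s ≤ T) :
    ∑ t ∈ Finset.Ico s T, (u t - u (t + 1)) + u T = u s := by
  induction T, h using Nat.le_induction with
  | base => simp
  | succ T h ih =>
    rw [Finset.sum_Ico_succ_top h, add_assoc, tsub_add_cancel_of_le (hu T.le_succ), ih]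

lemma sum_range_tsub {u : ℕ → ℝ≥0} (hu : Antitone u) (T : ℕ) :
    ∑ t ∈ Finset.range T, (u t - u (t + 1)) = u 0 - u T := by
  rw [← sum_Ico_tsub_add hu (Nat.zero_le T), Finset.range_eq_Ico, add_tsub_cancel_right]

lemma measurable_loss {u : ℕ → E → ℝ≥0} (hu : ∀ t, Measurable (u t)) (t : ℕ) :
    Measurable fun x => ((u t x - u (t + 1) x : ℝ≥0) : ℝ≥0∞) :=
  ((hu t).sub (hu (t + 1))).coe_nnreal_ennreal

/-- The part of `μ` which is lost when the density `u t` decreases to `u (t + 1)`. -/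
noncomputable def lossMeasure (μ : Measure E) (u : ℕ → E → ℝ≥0) (t : ℕ) : Measure E :=
  μ.withDensity fun x => ((u t x - u (t + 1) x : ℝ≥0) : ℝ≥0∞)

/-- The mass `u T • μ` placed on the diagonal, and the measures `ρ t` for the steps `t < T`. -/
noncomputable def splitCoupling (μ : Measure E) (u : ℕ → E → ℝ≥0) (T : ℕ)
    (ρ : ℕ → Measure (E × E)) : Measure (E × E) :=
  ∑ t ∈ Finset.range T, ρ t + (μ.withDensity fun x => (u T x : ℝ≥0∞)).map Function.diag

/-- This symmetry lets each property of the second coordinate be read off from that of the first. -/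
lemma map_swap_splitCoupling {μ ν : Measure E} {u v : ℕ → E → ℝ≥0} {T : ℕ}
    {ρ : ℕ → Measure (E × E)}
    (h : (μ.withDensity fun x => (u T x : ℝ≥0∞)) = ν.withDensity fun x => (v T x : ℝ≥0∞)) :
    (splitCoupling μ u T ρ).map Prod.swap = splitCoupling ν v T fun t => (ρ t).map Prod.swap := by
  have hd : Measurable (Function.diag : E → E × E) := measurable_id.prodMk measurable_id
  rw [splitCoupling, splitCoupling, h, Measure.map_add _ _ measurable_swap,
    Measure.map_map measurable_swap hd]
  congr 1
  simp_rw [← Measure.mapₗ_apply_of_measurable measurable_swap, map_sum]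

variable {μ : Measure E} {F : ℕ → MeasurableSpace E} {u : ℕ → E → ℝ≥0} {ρ : ℕ → Measure (E × E)}

/-- In the pieces `ρ t` with `t ≥ s` the two coordinates agree on `F s`, so their masses telescope
with the diagonal part to the density `u s`. -/
lemma splitCoupling_prod_eq (hF : Monotone F) (hFle : ∀ t, F t ≤ mE)
    (hu : ∀ t, Measurable[F t] (u t)) (hanti : ∀ x, Antitone fun t => u t x)
    (hρ : ∀ t, IsGluedLeft (F t) (lossMeasure μ u t) (ρ t)) {s T : ℕ} (hs : s ≤ T) {A B : Set E}
    (hA : MeasurableSet A) (hB : MeasurableSet[F s] B) :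
    splitCoupling μ u T ρ (A ×ˢ B)
      = ∑ t ∈ Finset.range s, ρ t (A ×ˢ B) + ∫⁻ x in A ∩ B, u s x ∂μ := by
  have hB' : MeasurableSet B := hFle s _ hB
  have hum : ∀ t, Measurable (u t) := fun t => (hu t).mono (hFle t) le_rfl
  have hd : Measurable (Function.diag : E → E × E) := measurable_id.prodMk measurable_id
  have hdiag : ((μ.withDensity fun x => (u T x : ℝ≥0∞)).map Function.diag) (A ×ˢ B)
      = ∫⁻ x in A ∩ B, u T x ∂μ := by
    rw [Measure.map_apply hd (hA.prod hB'), ← withDensity_apply _ (hA.inter hB')]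
    rfl
  have hρt : ∀ t ∈ Finset.Ico s T, ρ t (A ×ˢ B)
      = ∫⁻ x in A ∩ B, ((u t x - u (t + 1) x : ℝ≥0) : ℝ≥0∞) ∂μ := by
    intro t ht
    rw [(hρ t).inter A B hA (hF (Finset.mem_Ico.1 ht).1 _ hB), lossMeasure,
      withDensity_apply _ (hA.inter hB')]
  rw [splitCoupling, Measure.add_apply, Measure.finsetSum_apply, hdiag,
    ← Finset.sum_range_add_sum_Ico _ hs, Finset.sum_congr rfl hρt, add_assoc,
    ← lintegral_finsetSum _ fun t _ => measurable_loss hum t,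
    ← lintegral_add_right _ (hum T).coe_nnreal_ennreal]
  congr 1
  refine lintegral_congr fun x => ?_
  rw [← sum_Ico_tsub_add (hanti x) hs]
  push_cast
  rfl

/-- Only the pieces with `t < s` need a conditional density. It involves `u (t + 1)`, hence is `F (t
+ 1)`-measurable, and `t + 1 ≤ s`. -/
lemma exists_density_splitCoupling (hF : Monotone F) (hFle : ∀ t, F t ≤ mE)
    (hu : ∀ t, Measurable[F t] (u t)) (hanti : ∀ x, Antitone fun t => u t x)
    (hρ : ∀ t, IsGluedLeft (F t) (lossMeasure μ u t) (ρ t)) {s T : ℕ} (hs : s ≤ T) {B : Set E}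
    (hB : MeasurableSet[F s] B) :
    ∃ g : E → ℝ≥0∞, Measurable[F s] g ∧ ∀ A, MeasurableSet A →
      splitCoupling μ u T ρ (A ×ˢ B) = ∫⁻ x in A, g x ∂μ := by
  have hB' : MeasurableSet B := hFle s _ hB
  have hum : ∀ t, Measurable (u t) := fun t => (hu t).mono (hFle t) le_rfl
  choose g hg hgA using fun t => (hρ t).exists_density B hB'
  let w : ℕ → E → ℝ≥0∞ := fun t x => ((u t x - u (t + 1) x : ℝ≥0) : ℝ≥0∞) * g t x
  have hw : ∀ t, Measurable[F (t + 1)] (w t) := by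
    intro t
    exact (((hu t).mono (hF t.le_succ) le_rfl).sub (hu (t + 1))).coe_nnreal_ennreal.mul
      ((hg t).mono (hF t.le_succ) le_rfl)
  have hwm : ∀ t, Measurable (w t) := fun t => (hw t).mono (hFle _) le_rfl
  refine ⟨fun x => ∑ t ∈ Finset.range s, w t x + B.indicator (fun x => (u s x : ℝ≥0∞)) x, ?_, ?_⟩
  · refine Measurable.add (Finset.measurable_fun_sum _ fun t ht => ?_)
      (Measurable.indicator (hu s).coe_nnreal_ennreal hB)
    exact (hw t).mono (hF (Finset.mem_range.1 ht)) le_rfl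
  · intro A hA
    rw [splitCoupling_prod_eq hF hFle hu hanti hρ hs hA hB,
      lintegral_add_right _ ((hum s).coe_nnreal_ennreal.indicator hB'),
      lintegral_finsetSum _ fun t _ => hwm t, setLIntegral_indicator hB', Set.inter_comm B A]
    congr 1
    refine Finset.sum_congr rfl fun t _ => ?_
    rw [hgA t A hA, lossMeasure, restrict_withDensity hA,
      lintegral_withDensity_eq_lintegral_mul _
        (measurable_loss hum t) ((hg t).mono (hFle t) le_rfl)]
    rfl

lemma map_fst_splitCoupling (hF : Monotone F) (hFle : ∀ t, F t ≤ mE)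
    (hu : ∀ t, Measurable[F t] (u t)) (hanti : ∀ x, Antitone fun t => u t x)
    (hρ : ∀ t, IsGluedLeft (F t) (lossMeasure μ u t) (ρ t)) (h0 : ∀ x, u 0 x = 1) (T : ℕ) :
    (splitCoupling μ u T ρ).map Prod.fst = μ := by
  ext A hA
  rw [Measure.map_apply measurable_fst hA, ← Set.prod_univ,
    splitCoupling_prod_eq hF hFle hu hanti hρ (Nat.zero_le T) hA MeasurableSet.univ]
  simp [h0]

/-- The diagonal part costs nothing. On the pieces `ρ t` the indicator is bounded by one, and their
first marginals add up to density `1 - u T`. -/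
lemma lintegral_fst_ne_splitCoupling_le [MeasurableEq E]
    (hFle : ∀ t, F t ≤ mE)
    (hu : ∀ t, Measurable[F t] (u t)) (hanti : ∀ x, Antitone fun t => u t x)
    (hρ : ∀ t, IsGluedLeft (F t) (lossMeasure μ u t) (ρ t)) (h0 : ∀ x, u 0 x = 1) (T : ℕ)
    {φ : E → ℝ≥0∞} (hφ : Measurable φ) :
    ∫⁻ p, {p : E × E | p.1 ≠ p.2}.indicator (fun p => φ p.1) p ∂(splitCoupling μ u T ρ)
      ≤ ∫⁻ x, φ x * (1 - u T x : ℝ≥0) ∂μ := by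
  have hum : ∀ t, Measurable (u t) := fun t => (hu t).mono (hFle t) le_rfl
  have hd : Measurable (Function.diag : E → E × E) := measurable_id.prodMk measurable_id
  have hne : MeasurableSet {p : E × E | p.1 ≠ p.2} := measurableSet_diagonal.compl
  have hind : Measurable ({p : E × E | p.1 ≠ p.2}.indicator fun p => φ p.1) :=
    (hφ.comp measurable_fst).indicator hne
  have hfst : ∀ t, (ρ t).map Prod.fst = lossMeasure μ u t := by
    intro t
    ext A hA
    rw [Measure.map_apply measurable_fst hA, ← Set.prod_univ,
      (hρ t).inter A _ hA MeasurableSet.univ, Set.inter_univ]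
  have hstep : ∀ t, ∫⁻ p, {p : E × E | p.1 ≠ p.2}.indicator (fun p => φ p.1) p ∂(ρ t)
      ≤ ∫⁻ x, φ x * ((u t x - u (t + 1) x : ℝ≥0) : ℝ≥0∞) ∂μ := by
    intro t
    calc _ ≤ ∫⁻ p, φ p.1 ∂(ρ t) :=
          lintegral_mono fun p => Set.indicator_le_self _ (fun p : E × E => φ p.1) p
      _ = ∫⁻ x, φ x ∂(lossMeasure μ u t) := by rw [← hfst t, lintegral_map hφ measurable_fst]
      _ = _ := by
        rw [lossMeasure, lintegral_withDensity_eq_lintegral_mul _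
          (measurable_loss hum t) hφ]
        refine lintegral_congr fun x => ?_
        rw [Pi.mul_apply, mul_comm]
  rw [splitCoupling, lintegral_add_measure, lintegral_finsetSum_measure, lintegral_map hind hd]
  have hz : ∀ x : E, {p : E × E | p.1 ≠ p.2}.indicator (fun p => φ p.1) (Function.diag x) = 0 := by
    intro x
    simp [Function.diag]
  simp only [hz, lintegral_zero, add_zero]
  refine (Finset.sum_le_sum fun t _ => hstep t).trans (le_of_eq ?_)
  rw [← lintegral_finsetSum _ fun t _ => hφ.fun_mul (measurable_loss hum t)]
  refine lintegral_congr fun x => ?_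
  rw [← Finset.mul_sum, ← h0 x, ← sum_range_tsub (hanti x)]
  push_cast
  rfl

end Mixture

/-- Two decreasing adapted densities, equal to one at time zero and turning `μ` and `ν` into the
same measure on every `F t`, give a coupling of `μ` and `ν` that is causal in both directions and
charges the complement of the diagonal by at most the lost mass. -/
theorem exists_bicausal_splitCoupling {E : Type*} {mE : MeasurableSpace E} [StandardBorelSpace E]
    {μ ν : Measure E} [IsProbabilityMeasure μ] [IsProbabilityMeasure ν]
    {F : ℕ → MeasurableSpace E} (hF : Monotone F) (hFle : ∀ t, F t ≤ mE) {T : ℕ} (hT : mE ≤ F T)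
    {u v : ℕ → E → ℝ≥0} (hu : ∀ t, Measurable[F t] (u t)) (hv : ∀ t, Measurable[F t] (v t))
    (hua : ∀ x, Antitone fun t => u t x) (hva : ∀ x, Antitone fun t => v t x)
    (hu0 : ∀ x, u 0 x = 1) (hv0 : ∀ x, v 0 x = 1)
    (huv : ∀ t A, MeasurableSet[F t] A → ∫⁻ x in A, u t x ∂μ = ∫⁻ x in A, v t x ∂ν) :
    ∃ π : Measure (E × E), π.map Prod.fst = μ ∧ π.map Prod.snd = ν ∧
      (∀ s ≤ T, ∀ B, MeasurableSet[F s] B → ∃ g : E → ℝ≥0∞, Measurable[F s] g ∧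
        ∀ A, MeasurableSet A → π (A ×ˢ B) = ∫⁻ x in A, g x ∂μ) ∧
      (∀ s ≤ T, ∀ A, MeasurableSet[F s] A → ∃ g : E → ℝ≥0∞, Measurable[F s] g ∧
        ∀ B, MeasurableSet B → π (A ×ˢ B) = ∫⁻ y in B, g y ∂ν) ∧
      ∀ φ : E → ℝ≥0∞, Measurable φ →
        ∫⁻ p, {p : E × E | p.1 ≠ p.2}.indicator (fun p => φ p.1 + φ p.2) p ∂π
          ≤ ∫⁻ x, φ x * (1 - u T x : ℝ≥0) ∂μ + ∫⁻ y, φ y * (1 - v T y : ℝ≥0) ∂ν := by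
  have hum : ∀ t, Measurable (u t) := fun t => (hu t).mono (hFle t) le_rfl
  have hvm : ∀ t, Measurable (v t) := fun t => (hv t).mono (hFle t) le_rfl
  have hloss : ∀ (γ : Measure E) [IsProbabilityMeasure γ] (w : ℕ → E → ℝ≥0),
      (∀ x, Antitone fun t => w t x) → (∀ x, w 0 x = 1) → ∀ t,
      ∫⁻ x, w t x ∂γ ≠ ∞ := by
    intro γ _ w hw hw0 t
    have h1 : ∫⁻ x, w t x ∂γ ≤ 1 := by
      calc ∫⁻ x, w t x ∂γ ≤ ∫⁻ _, (1 : ℝ≥0∞) ∂γ := lintegral_mono fun x => by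
            have h : w t x ≤ 1 := (hw x (Nat.zero_le t)).trans_eq (hw0 x)
            exact ENNReal.coe_le_coe.2 h
        _ = 1 := by simp
    exact ne_top_of_le_ne_top ENNReal.one_ne_top h1
  have hfin : ∀ (γ : Measure E) [IsProbabilityMeasure γ] (w : ℕ → E → ℝ≥0),
      (∀ x, Antitone fun t => w t x) → (∀ x, w 0 x = 1) → ∀ t,
      IsFiniteMeasure (lossMeasure γ w t) := by
    intro γ _ w hw hw0 t
    refine isFiniteMeasure_withDensity (ne_top_of_le_ne_top (hloss γ w hw hw0 t) ?_)
    exact lintegral_mono fun x => ENNReal.coe_le_coe.2 tsub_le_self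
  have hsplit : ∀ (γ : Measure E) [IsProbabilityMeasure γ] (w : ℕ → E → ℝ≥0),
      (∀ t, Measurable (w t)) →
      (∀ x, Antitone fun t => w t x) → (∀ x, w 0 x = 1) → ∀ t A, MeasurableSet A →
      lossMeasure γ w t A = ∫⁻ x in A, w t x ∂γ - ∫⁻ x in A, w (t + 1) x ∂γ := by
    intro γ _ w hwm hw hw0 t A hA
    rw [lossMeasure, withDensity_apply _ hA, ← lintegral_sub (hwm (t + 1)).coe_nnreal_ennreal
      (ne_top_of_le_ne_top (hloss γ w hw hw0 (t + 1)) (setLIntegral_le_lintegral _ _))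
      (Filter.Eventually.of_forall fun x => ENNReal.coe_le_coe.2 (hw x t.le_succ))]
    simp
  have hglue : ∀ t, ∃ ρ : Measure (E × E), IsGluedLeft (F t) (lossMeasure μ u t) ρ ∧
      IsGluedLeft (F t) (lossMeasure ν v t) (ρ.map Prod.swap) := by
    intro t
    have := hfin μ u hua hu0 t
    have := hfin ν v hva hv0 t
    -- Both losses are differences of masses that agree at times `t` and `t + 1`; the latter applies
    -- since `A` also lies in `F (t + 1)`.
    refine exists_glued (hFle t) _ _ fun A hA => ?_
    rw [hsplit μ u hum hua hu0 t A (hFle t _ hA), hsplit ν v hvm hva hv0 t A (hFle t _ hA),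
      huv t A hA, huv (t + 1) A (hF t.le_succ _ hA)]
  choose ρ hρu hρv using hglue
  have hdiag : (μ.withDensity fun x => (u T x : ℝ≥0∞)) = ν.withDensity fun x => (v T x : ℝ≥0∞) := by
    ext A hA
    rw [withDensity_apply _ hA, withDensity_apply _ hA, huv T A (hT _ hA)]
  have hswap := map_swap_splitCoupling (ρ := ρ) hdiag
  refine ⟨splitCoupling μ u T ρ, map_fst_splitCoupling hF hFle hu hua hρu hu0 T, ?_,
    fun s hs B hB => exists_density_splitCoupling hF hFle hu hua hρu hs hB, fun s hs A hA => ?_,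
    fun φ hφ => ?_⟩
  · rw [← map_fst_splitCoupling hF hFle hv hva hρv hv0 T, ← hswap,
      Measure.map_map measurable_fst measurable_swap]
    rfl
  · obtain ⟨g, hg, hgB⟩ := exists_density_splitCoupling hF hFle hv hva hρv hs hA
    refine ⟨g, hg, fun B hB => ?_⟩
    rw [← hgB B hB, ← hswap, Measure.map_apply measurable_swap (hB.prod (hFle s _ hA)),
      Set.preimage_swap_prod]
  · have hne : MeasurableSet {p : E × E | p.1 ≠ p.2} := measurableSet_diagonal.compl
    have hind : Measurable ({p : E × E | p.1 ≠ p.2}.indicator fun p => φ p.1) :=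
      (hφ.comp measurable_fst).indicator hne
    have h2 := lintegral_fst_ne_splitCoupling_le hFle hv hva hρv hv0 T hφ
    rw [← hswap, lintegral_map hind measurable_swap] at h2
    have h1 := lintegral_fst_ne_splitCoupling_le hFle hu hua hρu hu0 T hφ
    refine le_trans (le_of_eq ?_) (add_le_add h1 h2)
    rw [← lintegral_add_left hind]
    refine lintegral_congr fun p => ?_
    by_cases hp : p.1 = p.2
    · simp [hp]
    · simp [hp, Ne.symm hp]

/-! ### Scalar inequalities for entropy and the kept weights -/

section Scalar

/-- Fenchel–Young inequality: the convex conjugate of `klFun` is `exp u - 1`. -/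
lemma mul_le_klFun_add_exp {b : ℝ} (hb : 0 ≤ b) (u : ℝ) : b * u ≤ klFun b - 1 + Real.exp u := by
  rcases hb.eq_or_lt with rfl | hb
  · simp [klFun_zero, Real.exp_nonneg]
  · have h := mul_le_mul_of_nonneg_left (Real.add_one_le_exp (u - Real.log b)) hb.le
    rw [Real.exp_sub, Real.exp_log hb, mul_div_cancel₀ _ hb.ne'] at h
    rw [klFun_apply]
    nlinarith

/-- Since `sinh y ≤ y` for `y ≤ 0`, taking `y = log x` gives `x * log x ≥ (x ^ 2 - 1) / 2`. -/
lemma sq_one_sub_le_two_mul_klFun {x : ℝ} (h0 : 0 ≤ x) (h1 : x ≤ 1) :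
    (1 - x) ^ 2 ≤ 2 * klFun x := by
  rcases h0.eq_or_lt with rfl | h0
  · simp [klFun_zero]
  · have h := Real.sinh_le_self_iff.2 (Real.log_nonpos h0.le h1)
    rw [Real.sinh_log h0] at h
    have h2 := mul_le_mul_of_nonneg_left h h0.le
    have h3 : x * ((x - x⁻¹) / 2) = (x ^ 2 - 1) / 2 := by field_simp
    rw [klFun_apply]
    nlinarith

/-- From `log x ≥ 2 * (x - 1) / (x + 1)` one gets `klFun x ≥ (x - 1) ^ 2 / (x + 1)`, and `2 * x ≥ x
+ 1`. -/
lemma sq_sub_one_le_two_mul_mul_klFun {x : ℝ} (h1 : 1 ≤ x) :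
    (x - 1) ^ 2 ≤ 2 * (x * klFun x) := by
  have h0 : 0 < x := by linarith
  have h := Real.le_log_one_add_of_nonneg (sub_nonneg.2 h1)
  rw [add_sub_cancel, div_le_iff₀ (by linarith)] at h
  have h2 : (x - 1) ^ 2 * (x + 1) ≤ 2 * (x * klFun x) * (x + 1) := by
    rw [klFun_apply]
    nlinarith [mul_le_mul_of_nonneg_left h (sq_nonneg x), pow_nonneg (sub_nonneg.2 h1) 3]
  exact le_of_mul_le_mul_right h2 (by linarith)

/-- Decreasing weights `v` for which `v t * ℓ t` is decreasing as well. -/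
noncomputable def keptWeight (ℓ : ℕ → ℝ≥0) : ℕ → ℝ≥0
  | 0 => 1
  | t + 1 => min (keptWeight ℓ t) (keptWeight ℓ t * ℓ t / ℓ (t + 1))

variable (ℓ : ℕ → ℝ≥0)

lemma antitone_keptWeight : Antitone (keptWeight ℓ) :=
  antitone_nat_of_succ_le fun _ => min_le_left _ _

lemma keptWeight_le_one (t : ℕ) : keptWeight ℓ t ≤ 1 := antitone_keptWeight ℓ (Nat.zero_le t)

lemma keptWeight_succ_mul (t : ℕ) : keptWeight ℓ (t + 1) * ℓ (t + 1)
    = min (keptWeight ℓ t * ℓ (t + 1)) (keptWeight ℓ t * ℓ t) := by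
  -- Where `ℓ (t + 1) = 0`, division by zero makes the new weight vanish, but both sides are zero
  -- whatever its value.
  rcases eq_or_ne (ℓ (t + 1)) 0 with h | h
  · simp [h]
  · rw [keptWeight, min_mul_of_nonneg _ _ (zero_le), div_mul_cancel₀ _ h]

lemma antitone_keptWeight_mul : Antitone fun t => keptWeight ℓ t * ℓ t :=
  antitone_nat_of_succ_le fun t => by
    rw [keptWeight_succ_mul]
    exact min_le_right _ _

/-- The `μ`-side loses mass only where `ℓ` decreases, so the quadratic bound for ratios at most one
is the relevant one. The spare factors `v` and `v * ℓ t` are at most one. -/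
lemma sq_keptWeight_mul_sub_le (h0 : ℓ 0 = 1) (t : ℕ) :
    ((keptWeight ℓ t * ℓ t - keptWeight ℓ (t + 1) * ℓ (t + 1) : ℝ≥0) : ℝ) ^ 2
      ≤ 2 * (ℓ t * klFun (ℓ (t + 1) / ℓ t)) := by
  have hu : keptWeight ℓ t * ℓ t ≤ 1 := by
    have := antitone_keptWeight_mul ℓ (Nat.zero_le t)
    simpa [keptWeight, h0] using this
  have hv := keptWeight_le_one ℓ t
  rw [keptWeight_succ_mul]
  generalize keptWeight ℓ t = v at *
  generalize ℓ t = a at *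
  generalize ℓ (t + 1) = b at *
  rcases le_total a b with hab | hab
  · rw [min_eq_right (mul_le_mul_right hab v), tsub_self]
    have : 0 ≤ klFun ((b : ℝ) / a) := klFun_nonneg (by positivity)
    norm_num
    positivity
  · rw [min_eq_left (mul_le_mul_right hab v), NNReal.coe_sub (mul_le_mul_right hab v)]
    push_cast
    rcases eq_or_ne a 0 with rfl | ha
    · have : b = 0 := le_antisymm hab (zero_le)
      simp [this]
    have ha' : (0 : ℝ) < a := by exact_mod_cast pos_iff_ne_zero.2 ha
    have hu' : (v : ℝ) * a ≤ 1 := by exact_mod_cast hu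
    have hv' : (v : ℝ) ≤ 1 := by exact_mod_cast hv
    have hab' : (b : ℝ) ≤ a := by exact_mod_cast hab
    have hb0 : (0 : ℝ) ≤ b := b.2
    have hv0 : (0 : ℝ) ≤ v := v.2
    have h := sq_one_sub_le_two_mul_klFun (x := (b : ℝ) / a) (by positivity)
      ((div_le_one ha').2 hab')
    have h1 : ((v : ℝ) * a - v * b) ^ 2 = (v * (v * a)) * (a * (1 - b / a) ^ 2) := by
      field_simp
    rw [h1]
    calc _ ≤ 1 * ((a : ℝ) * (1 - b / a) ^ 2) := by
          refine mul_le_mul_of_nonneg_right ?_ (by positivity)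
          exact mul_le_one₀ hv' (by positivity) hu'
      _ ≤ _ := by nlinarith

/-- The `ν`-side loses mass only where `ℓ` increases. The factor `ℓ (t + 1)` turns an integral over
`μ` into one over `ν`. -/
lemma mul_sq_keptWeight_sub_le (t : ℕ) (h : ℓ t = 0 → ℓ (t + 1) = 0) :
    (ℓ (t + 1) : ℝ) * ((keptWeight ℓ t - keptWeight ℓ (t + 1) : ℝ≥0) : ℝ) ^ 2
      ≤ 2 * (ℓ t * klFun (ℓ (t + 1) / ℓ t)) := by
  have hv := keptWeight_le_one ℓ t
  rw [keptWeight]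
  generalize keptWeight ℓ t = v at *
  generalize ℓ t = a at *
  generalize ℓ (t + 1) = b at *
  have hk : 0 ≤ klFun ((b : ℝ) / a) := klFun_nonneg (by positivity)
  have hr : 0 ≤ 2 * ((a : ℝ) * klFun (b / a)) := by positivity
  rcases eq_or_ne b 0 with rfl | hb
  · simpa using hr
  have hb' : (0 : ℝ) < b := by exact_mod_cast pos_iff_ne_zero.2 hb
  have ha' : (0 : ℝ) < a := by exact_mod_cast pos_iff_ne_zero.2 fun ha => hb (h ha)
  rcases le_total b a with hab | hab
  · rw [min_eq_left ((le_div_iff₀ (pos_iff_ne_zero.2 hb)).2 (mul_le_mul_right hab v)), tsub_self]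
    simpa using hr
  · have hle : v * a / b ≤ v := (div_le_iff₀ (pos_iff_ne_zero.2 hb)).2 (mul_le_mul_right hab v)
    rw [min_eq_right hle, NNReal.coe_sub hle]
    push_cast
    have hv' : (v : ℝ) ≤ 1 := by exact_mod_cast hv
    have hab' : (a : ℝ) ≤ b := by exact_mod_cast hab
    have hv0 : (0 : ℝ) ≤ v := v.2
    have h := sq_sub_one_le_two_mul_mul_klFun (x := (b : ℝ) / a) ((one_le_div ha').2 hab')
    have h1 : (b : ℝ) * (v - v * a / b) ^ 2 = (v * v) * (a ^ 2 / b * (b / a - 1) ^ 2) := by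
      field_simp
    have h2 : 2 * ((a : ℝ) * klFun (b / a)) = a ^ 2 / b * (2 * (b / a * klFun (b / a))) := by
      field_simp
    rw [h1, h2]
    calc _ ≤ 1 * ((a : ℝ) ^ 2 / b * (b / a - 1) ^ 2) := by
          refine mul_le_mul_of_nonneg_right ?_ (by positivity)
          exact mul_le_one₀ hv' hv0 hv'
      _ ≤ _ := by
          rw [one_mul]
          exact mul_le_mul_of_nonneg_left h (by positivity)

/-- This is `klFun b = klFun a + a * klFun (b / a) + (b - a) * log a`, with the logarithm split so
that all terms are nonnegative and can be integrated in `ℝ≥0∞`. -/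
lemma klFun_chain {a b : ℝ} (ha : 0 ≤ a) (h : a = 0 → b = 0) :
    klFun b + b * (Real.log a)⁻ + a * (Real.log a)⁺
      = klFun a + a * klFun (b / a) + b * (Real.log a)⁺ + a * (Real.log a)⁻ := by
  rcases ha.eq_or_lt with rfl | ha
  · simp [h rfl]
  have hpm := posPart_sub_negPart (Real.log a)
  have : a * klFun (b / a) = klFun b - klFun a - (b - a) * Real.log a := by
    rcases eq_or_ne b 0 with rfl | hb
    · simp only [klFun_apply, zero_div, zero_mul]
      ring
    · simp only [klFun_apply]
      rw [Real.log_div hb ha.ne']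
      field_simp
      ring
  rw [this]
  linear_combination (a - b) * hpm

end Scalar

/-! ### One step of the entropy chain rule -/

section Entropy

variable {E : Type*} {m mE : MeasurableSpace E} {μ : Measure E}

/-- By `hab`, `a` is the conditional expectation of `b` given `m`. The logarithmic terms of
`klFun_chain` have `m`-measurable coefficients, so they have equal integrals on the two sides and
cancel once known to be finite. -/
lemma lintegral_klFun_add_le [IsFiniteMeasure μ] (hm : m ≤ mE) {a b : E → ℝ≥0}
    (ha : Measurable[m] a) (hb : Measurable b)
    (hab : ∀ g : E → ℝ≥0∞, Measurable[m] g → ∫⁻ x, g x * a x ∂μ = ∫⁻ x, g x * b x ∂μ)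
    (hafin : ∫⁻ x, a x ∂μ ≠ ∞) (hfin : ∫⁻ x, ENNReal.ofReal (klFun (b x)) ∂μ ≠ ∞) :
    ∫⁻ x, ENNReal.ofReal (klFun (a x)) ∂μ + ∫⁻ x, ENNReal.ofReal (a x * klFun (b x / a x)) ∂μ
      ≤ ∫⁻ x, ENNReal.ofReal (klFun (b x)) ∂μ := by
  have ham : Measurable a := ha.mono hm le_rfl
  have hz : ∀ᵐ x ∂μ, a x = 0 → b x = 0 := by
    have hs : MeasurableSet[m] {x | a x = 0} := ha (measurableSet_singleton 0)
    have h := hab ({x | a x = 0}.indicator fun _ => 1) (Measurable.indicator measurable_const hs)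
    have h0 : ∀ x, {x | a x = 0}.indicator (fun _ => (1 : ℝ≥0∞)) x * a x = 0 := by
      intro x
      by_cases hx : a x = 0 <;> simp [hx]
    simp only [h0, lintegral_zero] at h
    rw [eq_comm, lintegral_eq_zero_iff
      ((measurable_const.indicator (hm _ hs)).fun_mul hb.coe_nnreal_ennreal)] at h
    filter_upwards [h] with x hx hax
    simpa [hax] using hx
  have hpos : Measurable[m] fun x => ENNReal.ofReal (Real.log (a x))⁺ := by
    have : Measurable[m] fun x => Real.log (a x) := Real.measurable_log.comp ha.coe_nnreal_real
    exact (this.max measurable_const).ennreal_ofReal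
  have hneg : Measurable[m] fun x => ENNReal.ofReal (Real.log (a x))⁻ := by
    have : Measurable[m] fun x => Real.log (a x) := Real.measurable_log.comp ha.coe_nnreal_real
    exact (this.neg.max measurable_const).ennreal_ofReal
  have hposm := hpos.mono hm le_rfl
  have hnegm := hneg.mono hm le_rfl
  have hkb : Measurable fun x => ENNReal.ofReal (klFun (b x)) :=
    (measurable_klFun.comp hb.coe_nnreal_real).ennreal_ofReal
  have hnegfin : ∫⁻ x, ENNReal.ofReal (Real.log (a x))⁻ * a x ∂μ ≠ ∞ := by
    refine ne_top_of_le_ne_top (measure_ne_top μ Set.univ) ?_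
    rw [← lintegral_one]
    refine lintegral_mono fun x => ?_
    simp only
    rw [← ENNReal.ofReal_coe_nnreal, ← ENNReal.ofReal_mul (negPart_nonneg _),
      ENNReal.ofReal_le_one]
    have h := klFun_nonneg (x := (a x : ℝ)) (a x).2
    rw [klFun_apply] at h
    have h0 : (0 : ℝ) ≤ a x := (a x).2
    rcases le_total (Real.log (a x)) 0 with hl | hl
    · rw [negPart_eq_neg.2 hl]
      nlinarith
    · rw [negPart_eq_zero.2 hl]
      simp
  have hposfin : ∫⁻ x, ENNReal.ofReal (Real.log (a x))⁺ * a x ∂μ ≠ ∞ := by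
    rw [hab _ hpos]
    refine ne_top_of_le_ne_top (ENNReal.add_ne_top.2 ⟨hfin, hafin⟩) ?_
    rw [← lintegral_add_left hkb]
    refine lintegral_mono fun x => ?_
    simp only
    have hk := klFun_nonneg (x := (b x : ℝ)) (b x).2
    rw [← ENNReal.ofReal_coe_nnreal (p := a x), ← ENNReal.ofReal_coe_nnreal (p := b x),
      ← ENNReal.ofReal_mul (posPart_nonneg _), ← ENNReal.ofReal_add hk (a x).coe_nonneg]
    refine ENNReal.ofReal_le_ofReal ?_
    have hb0 : (0 : ℝ) ≤ b x := (b x).2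
    have ha0 : (0 : ℝ) ≤ a x := (a x).2
    rcases le_total (Real.log (a x)) 0 with hl | hl
    · rw [posPart_eq_zero.2 hl]
      linarith
    · rw [posPart_eq_self.2 hl]
      rcases ha0.eq_or_lt with h0 | h0
      · rw [← h0]
        simpa using hk
      -- Fenchel–Young with exponent `log a` controls `b * log a` by `klFun b + a`, both integrable.
      · have := mul_le_klFun_add_exp hb0 (Real.log (a x))
        rw [Real.exp_log h0] at this
        linarith
  have hD : Measurable fun x => ENNReal.ofReal (a x * klFun (b x / a x)) :=
    (ham.coe_nnreal_real.mul (measurable_klFun.comp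
      (hb.coe_nnreal_real.div ham.coe_nnreal_real))).ennreal_ofReal
  have hac := ham.coe_nnreal_ennreal
  have hbc := hb.coe_nnreal_ennreal
  have key : ∫⁻ x, (ENNReal.ofReal (klFun (b x)) + ENNReal.ofReal (Real.log (a x))⁻ * b x
        + ENNReal.ofReal (Real.log (a x))⁺ * a x) ∂μ
      = ∫⁻ x, (ENNReal.ofReal (klFun (a x)) + ENNReal.ofReal (a x * klFun (b x / a x))
        + ENNReal.ofReal (Real.log (a x))⁺ * b x + ENNReal.ofReal (Real.log (a x))⁻ * a x) ∂μ := by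
    refine lintegral_congr_ae ?_
    filter_upwards [hz] with x hx
    have h := klFun_chain (a := (a x : ℝ)) (b := (b x : ℝ)) (a x).2 (by exact_mod_cast hx)
    have ha0 : (0 : ℝ) ≤ a x := (a x).2
    have hb0 : (0 : ℝ) ≤ b x := (b x).2
    have h1 := klFun_nonneg hb0
    have h2 := klFun_nonneg ha0
    have h3 := klFun_nonneg (x := (b x : ℝ) / a x) (by positivity)
    have h4 := posPart_nonneg (Real.log (a x))
    have h5 := negPart_nonneg (Real.log (a x))
    simp only [← ENNReal.ofReal_coe_nnreal (p := a x), ← ENNReal.ofReal_coe_nnreal (p := b x)]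
    rw [← ENNReal.ofReal_mul h5, ← ENNReal.ofReal_mul h4, ← ENNReal.ofReal_mul h5,
      ← ENNReal.ofReal_mul h4, ← ENNReal.ofReal_add h1 (by positivity),
      ← ENNReal.ofReal_add (by positivity) (by positivity),
      ← ENNReal.ofReal_add h2 (by positivity), ← ENNReal.ofReal_add (by positivity) (by positivity),
      ← ENNReal.ofReal_add (by positivity) (by positivity)]
    congr 1
    linarith
  rw [lintegral_add_right _ (hposm.fun_mul hac), lintegral_add_right _ (hnegm.fun_mul hbc),
    lintegral_add_right _ (hnegm.fun_mul hac), lintegral_add_right _ (hposm.fun_mul hbc),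
    lintegral_add_right _ hD, ← hab _ hpos, ← hab _ hneg, add_assoc, add_assoc,
    add_comm (∫⁻ x, ENNReal.ofReal (Real.log (a x))⁻ * a x ∂μ)] at key
  exact (ENNReal.add_le_add_iff_right (ENNReal.add_ne_top.2 ⟨hposfin, hnegfin⟩)).1 key.ge

end Entropy

/-! ### Densities on sub-σ-algebras -/

section Density

variable {E : Type*} {m mE : MeasurableSpace E} {μ ν : Measure E}

lemma exists_density_of_absolutelyContinuous [IsFiniteMeasure μ] [IsFiniteMeasure ν] (hm : m ≤ mE)
    (h : ν ≪ μ) : ∃ ℓ : E → ℝ≥0, Measurable[m] ℓ ∧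
      ∀ A, MeasurableSet[m] A → ν A = ∫⁻ x in A, ℓ x ∂μ := by
  have hac : ν.trim hm ≪ μ.trim hm := h.trim hm
  refine ⟨fun x => ((ν.trim hm).rnDeriv (μ.trim hm) x).toNNReal,
    (Measure.measurable_rnDeriv _ _).ennreal_toNNReal, fun A hA => ?_⟩
  have hmeas : Measurable[m]
      fun x => ((((ν.trim hm).rnDeriv (μ.trim hm) x).toNNReal : ℝ≥0) : ℝ≥0∞) :=
    (Measure.measurable_rnDeriv _ _).ennreal_toNNReal.coe_nnreal_ennreal
  rw [← trim_measurableSet_eq hm hA, ← Measure.setLIntegral_rnDeriv hac A,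
    ← setLIntegral_trim hm hmeas hA]
  refine lintegral_congr_ae (ae_restrict_of_ae ?_)
  filter_upwards [Measure.rnDeriv_lt_top (ν.trim hm) (μ.trim hm)] with x hx
  rw [ENNReal.coe_toNNReal hx.ne]

lemma lintegral_eq_lintegral_mul_density (hm : m ≤ mE) {ℓ : E → ℝ≥0} (hℓ : Measurable[m] ℓ)
    (h : ∀ A, MeasurableSet[m] A → ν A = ∫⁻ x in A, ℓ x ∂μ) {g : E → ℝ≥0∞} (hg : Measurable[m] g) :
    ∫⁻ x, g x ∂ν = ∫⁻ x, g x * ℓ x ∂μ := by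
  have hd : ν.trim hm = (μ.withDensity fun x => (ℓ x : ℝ≥0∞)).trim hm := by
    refine @Measure.ext _ m _ _ fun A hA => ?_
    rw [trim_measurableSet_eq hm hA, trim_measurableSet_eq hm hA, h A hA,
      withDensity_apply _ (hm A hA)]
  rw [← lintegral_trim hm hg, hd, lintegral_trim hm hg, lintegral_withDensity_eq_lintegral_mul _
    (hℓ.mono hm le_rfl).coe_nnreal_ennreal (hg.mono hm le_rfl)]
  refine lintegral_congr fun x => ?_
  rw [Pi.mul_apply, mul_comm]

end Density

/-! ### Second moments of the losses and of the weight -/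

section Filtration

variable {E : Type*} {mE : MeasurableSpace E} {μ ν : Measure E} {F : ℕ → MeasurableSpace E}
  {ℓ : ℕ → E → ℝ≥0}

lemma measurable_keptWeight (hF : Monotone F) (hℓ : ∀ t, Measurable[F t] (ℓ t)) (t : ℕ) :
    Measurable[F t] fun x => keptWeight (fun s => ℓ s x) t := by
  induction t with
  | zero => exact measurable_const
  | succ t ih =>
    have ih' := ih.mono (hF t.le_succ) le_rfl
    exact ih'.min ((ih'.mul ((hℓ t).mono (hF t.le_succ) le_rfl)).div (hℓ (t + 1)))

/-- The chain rule for the relative entropy along a filtration, as an inequality. -/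
lemma sum_lintegral_klFun_div_le [IsFiniteMeasure μ] [IsFiniteMeasure ν] (hF : Monotone F)
    (hFle : ∀ t, F t ≤ mE) (hℓ : ∀ t, Measurable[F t] (ℓ t))
    (hν : ∀ t (g : E → ℝ≥0∞), Measurable[F t] g → ∫⁻ x, g x ∂ν = ∫⁻ x, g x * ℓ t x ∂μ)
    (T : ℕ) (hfin : ∫⁻ x, ENNReal.ofReal (klFun (ℓ T x)) ∂μ ≠ ∞) :
    ∑ t ∈ Finset.range T, ∫⁻ x, ENNReal.ofReal (ℓ t x * klFun (ℓ (t + 1) x / ℓ t x)) ∂μ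
      ≤ ∫⁻ x, ENNReal.ofReal (klFun (ℓ T x)) ∂μ := by
  induction T with
  | zero => simp
  | succ T ih =>
    have hint : ∫⁻ x, ℓ T x ∂μ ≠ ∞ := by
      have := hν T (fun _ => 1) measurable_const
      simp only [one_mul] at this
      rw [← this]
      simp
    have hstep := lintegral_klFun_add_le (hFle T) (hℓ T) ((hℓ (T + 1)).mono (hFle _) le_rfl)
      (fun g hg => by rw [← hν T g hg, hν (T + 1) g (hg.mono (hF T.le_succ) le_rfl)]) hint hfin
    rw [Finset.sum_range_succ]
    -- The one-step inequality also passes finiteness of the entropy from `T + 1` down to `T`.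
    exact (add_le_add_left (ih (ne_top_of_le_ne_top hfin (le_self_add.trans hstep))) _).trans hstep

/-- Cauchy–Schwarz on a telescoping sum of `T` terms; this is the origin of the factor `√T`. -/
lemma lintegral_sq_one_sub_le {γ : Measure E} {w : ℕ → E → ℝ≥0} (hw : ∀ t, Measurable (w t))
    (hanti : ∀ x, Antitone fun t => w t x) (h0 : ∀ x, w 0 x = 1) (T : ℕ) :
    ∫⁻ x, ((1 - w T x : ℝ≥0) : ℝ≥0∞) ^ 2 ∂γ
      ≤ T * ∑ t ∈ Finset.range T, ∫⁻ x, ((w t x - w (t + 1) x : ℝ≥0) : ℝ≥0∞) ^ 2 ∂γ := by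
  rw [← lintegral_finsetSum _ fun t _ => (measurable_loss hw t).pow_const 2,
    ← lintegral_const_mul _ (Finset.measurable_fun_sum _ fun t _ =>
      (measurable_loss hw t).pow_const 2)]
  refine lintegral_mono fun x => ?_
  have h : (1 - w T x) ^ 2 ≤ T * ∑ t ∈ Finset.range T, (w t x - w (t + 1) x) ^ 2 := by
    rw [← h0 x, ← sum_range_tsub (hanti x), ← NNReal.coe_le_coe]
    push_cast
    simpa using sq_sum_le_card_mul_sum_sq (s := Finset.range T)
      (f := fun t => ((w t x - w (t + 1) x : ℝ≥0) : ℝ))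
  have h' := ENNReal.coe_le_coe.2 h
  push_cast at h' ⊢
  exact h'

lemma coe_sq_le_two_mul_ofReal {c : ℝ≥0} {r : ℝ} (h : (c : ℝ) ^ 2 ≤ 2 * r) :
    (c : ℝ≥0∞) ^ 2 ≤ 2 * ENNReal.ofReal r := by
  rw [← ENNReal.ofReal_coe_nnreal, ← ENNReal.ofReal_pow c.coe_nonneg,
    ← ENNReal.ofReal_ofNat 2, ← ENNReal.ofReal_mul (by norm_num)]
  exact ENNReal.ofReal_le_ofReal h

lemma lintegral_sq_one_sub_keptWeight_mul_le [IsFiniteMeasure μ] [IsFiniteMeasure ν]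
    (hF : Monotone F) (hFle : ∀ t, F t ≤ mE) (hℓ : ∀ t, Measurable[F t] (ℓ t))
    (h0 : ∀ x, ℓ 0 x = 1)
    (hν : ∀ t (g : E → ℝ≥0∞), Measurable[F t] g → ∫⁻ x, g x ∂ν = ∫⁻ x, g x * ℓ t x ∂μ)
    (T : ℕ) (hfin : ∫⁻ x, ENNReal.ofReal (klFun (ℓ T x)) ∂μ ≠ ∞) :
    ∫⁻ x, ((1 - keptWeight (fun s => ℓ s x) T * ℓ T x : ℝ≥0) : ℝ≥0∞) ^ 2 ∂μ
      ≤ T * (2 * ∫⁻ x, ENNReal.ofReal (klFun (ℓ T x)) ∂μ) := by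
  have hm : ∀ t, Measurable fun x => keptWeight (fun s => ℓ s x) t * ℓ t x := fun t =>
    ((measurable_keptWeight hF hℓ t).mul (hℓ t)).mono (hFle t) le_rfl
  refine (lintegral_sq_one_sub_le hm (fun x => antitone_keptWeight_mul _)
    (fun x => by simp [keptWeight, h0]) T).trans ?_
  refine mul_le_mul_right ?_ _
  refine le_trans ?_ (mul_le_mul_right (sum_lintegral_klFun_div_le hF hFle hℓ hν T hfin) 2)
  rw [Finset.mul_sum]
  refine Finset.sum_le_sum fun t _ => ?_
  rw [← lintegral_const_mul' _ _ (by simp)]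
  exact lintegral_mono fun x => coe_sq_le_two_mul_ofReal
    (sq_keptWeight_mul_sub_le (fun s => ℓ s x) (h0 x) t)

lemma lintegral_sq_one_sub_keptWeight_le [IsFiniteMeasure μ] [IsFiniteMeasure ν]
    (hF : Monotone F) (hFle : ∀ t, F t ≤ mE) (hℓ : ∀ t, Measurable[F t] (ℓ t))
    (hν : ∀ t (g : E → ℝ≥0∞), Measurable[F t] g → ∫⁻ x, g x ∂ν = ∫⁻ x, g x * ℓ t x ∂μ)
    (T : ℕ) (hfin : ∫⁻ x, ENNReal.ofReal (klFun (ℓ T x)) ∂μ ≠ ∞) :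
    ∫⁻ x, ((1 - keptWeight (fun s => ℓ s x) T : ℝ≥0) : ℝ≥0∞) ^ 2 ∂ν
      ≤ T * (2 * ∫⁻ x, ENNReal.ofReal (klFun (ℓ T x)) ∂μ) := by
  have hm : ∀ t, Measurable fun x => keptWeight (fun s => ℓ s x) t := fun t =>
    (measurable_keptWeight hF hℓ t).mono (hFle t) le_rfl
  refine (lintegral_sq_one_sub_le hm (fun x => antitone_keptWeight _)
    (fun x => rfl) T).trans ?_
  refine mul_le_mul_right ?_ _
  refine le_trans ?_ (mul_le_mul_right (sum_lintegral_klFun_div_le hF hFle hℓ hν T hfin) 2)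
  rw [Finset.mul_sum]
  refine Finset.sum_le_sum fun t _ => ?_
  have hz : ∀ᵐ x ∂μ, ℓ t x = 0 → ℓ (t + 1) x = 0 := by
    have hs : MeasurableSet[F t] {x | ℓ t x = 0} := hℓ t (measurableSet_singleton 0)
    have hg : Measurable[F t] ({x | ℓ t x = 0}.indicator fun _ => (1 : ℝ≥0∞)) :=
      Measurable.indicator measurable_const hs
    have h := hν (t + 1) _ (hg.mono (hF t.le_succ) le_rfl)
    rw [hν t _ hg] at h
    have hzero : ∀ x, {x | ℓ t x = 0}.indicator (fun _ => (1 : ℝ≥0∞)) x * ℓ t x = 0 := by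
      intro x
      by_cases hx : ℓ t x = 0 <;> simp [hx]
    simp only [hzero, lintegral_zero] at h
    rw [eq_comm, lintegral_eq_zero_iff ((hg.mono (hFle t) le_rfl).fun_mul
      ((hℓ (t + 1)).mono (hFle _) le_rfl).coe_nnreal_ennreal)] at h
    filter_upwards [h] with x hx hax
    simpa [hax] using hx
  have hmeas : Measurable[F (t + 1)] fun x => ((keptWeight (fun s => ℓ s x) t
      - keptWeight (fun s => ℓ s x) (t + 1) : ℝ≥0) : ℝ≥0∞) ^ 2 :=
    ((((measurable_keptWeight hF hℓ t).mono (hF t.le_succ) le_rfl).sub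
      (measurable_keptWeight hF hℓ (t + 1))).coe_nnreal_ennreal).pow_const 2
  -- The loss of this step is `F (t + 1)`-measurable, so `ν` is replaced by `ℓ (t + 1) • μ`.
  rw [hν (t + 1) _ hmeas, ← lintegral_const_mul' _ _ (by simp)]
  refine lintegral_mono_ae ?_
  filter_upwards [hz] with x hx
  have h := mul_sq_keptWeight_sub_le (fun s => ℓ s x) t hx
  have h2 := ENNReal.ofReal_le_ofReal h
  rw [ENNReal.ofReal_mul (NNReal.coe_nonneg _), ENNReal.ofReal_mul (by norm_num),
    ENNReal.ofReal_pow (NNReal.coe_nonneg _), ENNReal.ofReal_coe_nnreal, ENNReal.ofReal_coe_nnreal,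
    ENNReal.ofReal_ofNat, mul_comm] at h2
  exact h2

/-- The Gibbs variational inequality for the exponential moment of `φ ^ 2`. -/
lemma lintegral_sq_mul_le [IsProbabilityMeasure μ] {b : E → ℝ≥0} (hb : Measurable b)
    (hb1 : ∫⁻ x, b x ∂μ = 1) {φ : E → ℝ≥0} (hφ : Measurable φ) :
    ∫⁻ x, (φ x : ℝ≥0∞) ^ 2 * b x ∂μ ≤ ∫⁻ x, ENNReal.ofReal (klFun (b x)) ∂μ
      + (ENNReal.log (∫⁻ x, ENNReal.ofReal (Real.exp ((φ x : ℝ) ^ 2)) ∂μ)).toENNReal := by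
  set Z := ∫⁻ x, ENNReal.ofReal (Real.exp ((φ x : ℝ) ^ 2)) ∂μ with hZ
  have hZ1 : 1 ≤ Z := by
    calc (1 : ℝ≥0∞) = ∫⁻ _, 1 ∂μ := by simp
      _ ≤ Z := lintegral_mono fun x => by
        rw [ENNReal.one_le_ofReal]
        exact Real.one_le_exp (by positivity)
  rcases eq_or_ne Z ∞ with hZt | hZt
  · simp [hZt]
  obtain ⟨z, hz⟩ : ∃ z : ℝ, z = Z.toReal := ⟨_, rfl⟩
  have hzZ : Z = ENNReal.ofReal z := by rw [hz, ENNReal.ofReal_toReal hZt]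
  have hz1 : 1 ≤ z := by
    rw [hzZ] at hZ1
    exact ENNReal.one_le_ofReal.1 hZ1
  have hz0 : 0 < z := by linarith
  have hlog : 0 ≤ Real.log z := Real.log_nonneg hz1
  have hlogZ : (ENNReal.log Z).toENNReal = ENNReal.ofReal (Real.log z) := by
    rw [hzZ, ENNReal.log_ofReal_of_pos hz0, EReal.toENNReal_of_ne_top (by simp), EReal.toReal_coe]
  rw [hlogZ]
  have hexp : Measurable fun x => ENNReal.ofReal (Real.exp ((φ x : ℝ) ^ 2)) :=
    (Real.measurable_exp.comp (hφ.coe_nnreal_real.pow_const 2)).ennreal_ofReal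
  have hpt : ∀ x, (φ x : ℝ≥0∞) ^ 2 * b x + 1 ≤ ENNReal.ofReal (klFun (b x))
      + ENNReal.ofReal (Real.log z) * b x
      + ENNReal.ofReal z⁻¹ * ENNReal.ofReal (Real.exp ((φ x : ℝ) ^ 2)) := by
    intro x
    have hb0 : (0 : ℝ) ≤ b x := (b x).coe_nonneg
    have hk0 := klFun_nonneg hb0
    -- Subtracting `log z` normalises the exponential to integral one, which cancels the `1` on the
    -- left after integration.
    have h := mul_le_klFun_add_exp hb0 ((φ x : ℝ) ^ 2 - Real.log z)
    rw [Real.exp_sub, Real.exp_log hz0, div_eq_inv_mul] at h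
    rw [← ENNReal.ofReal_coe_nnreal (p := φ x), ← ENNReal.ofReal_coe_nnreal (p := b x),
      ← ENNReal.ofReal_pow (φ x).coe_nonneg, ← ENNReal.ofReal_mul (by positivity),
      ← ENNReal.ofReal_mul hlog, ← ENNReal.ofReal_mul (by positivity), ← ENNReal.ofReal_one,
      ← ENNReal.ofReal_add (by positivity) zero_le_one, ← ENNReal.ofReal_add hk0 (by positivity),
      ← ENNReal.ofReal_add (by positivity) (by positivity)]
    refine ENNReal.ofReal_le_ofReal ?_
    nlinarith
  have h := lintegral_mono (μ := μ) hpt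
  rw [lintegral_add_right _ measurable_const,
    lintegral_add_right _ (hexp.const_mul _),
    lintegral_add_right _ (hb.coe_nnreal_ennreal.const_mul _), lintegral_const_mul _ hexp,
    lintegral_const_mul _ hb.coe_nnreal_ennreal, hb1, ← hZ, hzZ,
    ← ENNReal.ofReal_mul (by positivity), inv_mul_cancel₀ hz0.ne'] at h
  simp only [lintegral_const, measure_univ, mul_one, ENNReal.ofReal_one] at h
  exact (ENNReal.add_le_add_iff_right ENNReal.one_ne_top).1 h

end Filtration

/-! ### Cauchy–Schwarz, the constant, and the bound for a general filtration -/

lemma lintegral_mul_le_sqrt_mul_sqrt {E : Type*} {mE : MeasurableSpace E} {γ : Measure E}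
    {f g : E → ℝ≥0∞} (hf : Measurable f) (hg : Measurable g) {a b : ℝ≥0∞}
    (ha : ∫⁻ x, f x ^ 2 ∂γ ≤ a) (hb : ∫⁻ x, g x ^ 2 ∂γ ≤ b) :
    ∫⁻ x, f x * g x ∂γ ≤ a ^ (1 / 2 : ℝ) * b ^ (1 / 2 : ℝ) := by
  refine (ENNReal.lintegral_mul_le_Lp_mul_Lq γ Real.HolderConjugate.two_two hf.aemeasurable
    hg.aemeasurable).trans ?_
  simp only [ENNReal.rpow_ofNat]
  gcongr

/-- The weighted transport cost `A + B` is estimated by the square root of the entropy `K`, where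
`lz` is the logarithm of the exponential moment of the weight. -/
lemma add_le_mul_sqrt_entropy {T : ℕ} {A B lz K : ℝ≥0∞}
    (hA : A ≤ lz ^ (1 / 2 : ℝ) * (T * (2 * K)) ^ (1 / 2 : ℝ))
    (hB : B ≤ (K + lz) ^ (1 / 2 : ℝ) * (T * (2 * K)) ^ (1 / 2 : ℝ))
    (hA1 : A ≤ lz ^ (1 / 2 : ℝ)) (hB1 : B ≤ (K + lz) ^ (1 / 2 : ℝ)) :
    A + B ≤ ENNReal.ofReal (2 * Real.sqrt T + 1) * (1 + lz) ^ (1 / 2 : ℝ)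
      * (2 * K) ^ (1 / 2 : ℝ) := by
  have hhalf : (0 : ℝ) ≤ 1 / 2 := by norm_num
  have hT : (T : ℝ≥0∞) ^ (1 / 2 : ℝ) = ENNReal.ofReal (Real.sqrt T) := by
    rw [Real.sqrt_eq_rpow, ← ENNReal.ofReal_rpow_of_nonneg (Nat.cast_nonneg T) hhalf,
      ENNReal.ofReal_natCast]
  have hlz : lz ^ (1 / 2 : ℝ) ≤ (1 + lz) ^ (1 / 2 : ℝ) :=
    ENNReal.rpow_le_rpow le_add_self hhalf
  rcases Nat.eq_zero_or_pos T with rfl | hTpos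
  · simp only [Nat.cast_zero, zero_mul, ENNReal.zero_rpow_of_pos (one_half_pos (α := ℝ)),
      mul_zero] at hA hB
    rw [nonpos_iff_eq_zero.1 hA, nonpos_iff_eq_zero.1 hB]
    simp
  rcases le_total K 1 with hK | hK
  · have hKl : (K + lz) ^ (1 / 2 : ℝ) ≤ (1 + lz) ^ (1 / 2 : ℝ) :=
      ENNReal.rpow_le_rpow (add_le_add_left hK lz) hhalf
    rw [ENNReal.mul_rpow_of_nonneg _ _ hhalf, hT] at hA hB
    calc A + B ≤ (1 + lz) ^ (1 / 2 : ℝ) * (ENNReal.ofReal (Real.sqrt T) * (2 * K) ^ (1 / 2 : ℝ))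
          + (1 + lz) ^ (1 / 2 : ℝ) * (ENNReal.ofReal (Real.sqrt T) * (2 * K) ^ (1 / 2 : ℝ)) :=
          add_le_add (hA.trans (mul_le_mul_left hlz _)) (hB.trans (mul_le_mul_left hKl _))
      _ = ENNReal.ofReal (2 * Real.sqrt T) * (1 + lz) ^ (1 / 2 : ℝ) * (2 * K) ^ (1 / 2 : ℝ) := by
          rw [ENNReal.ofReal_mul (by norm_num), ENNReal.ofReal_ofNat]
          ring
      _ ≤ _ := by
          gcongr
          linarith
  -- For `K ≥ 1` the trivial bounds suffice, since `K + lz ≤ (1 + lz) * K`.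
  · have h2K : K ^ (1 / 2 : ℝ) ≤ (2 * K) ^ (1 / 2 : ℝ) :=
      ENNReal.rpow_le_rpow (by rw [two_mul]; exact le_self_add) hhalf
    have hA2 : A ≤ (1 + lz) ^ (1 / 2 : ℝ) * (2 * K) ^ (1 / 2 : ℝ) := by
      calc A ≤ (1 + lz) ^ (1 / 2 : ℝ) * 1 := by rw [mul_one]; exact hA1.trans hlz
        _ ≤ _ := mul_le_mul_right ((ENNReal.one_le_rpow hK (by norm_num)).trans h2K) _
    have hB2 : B ≤ (1 + lz) ^ (1 / 2 : ℝ) * (2 * K) ^ (1 / 2 : ℝ) := by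
      calc B ≤ (K + lz) ^ (1 / 2 : ℝ) := hB1
        _ ≤ ((1 + lz) * K) ^ (1 / 2 : ℝ) := by
            refine ENNReal.rpow_le_rpow ?_ hhalf
            rw [add_mul, one_mul]
            exact add_le_add_right (le_mul_of_one_le_right (zero_le) hK) K
        _ = (1 + lz) ^ (1 / 2 : ℝ) * K ^ (1 / 2 : ℝ) := ENNReal.mul_rpow_of_nonneg _ _ hhalf
        _ ≤ _ := mul_le_mul_right h2K _
    have hT1 : 1 ≤ Real.sqrt T := Real.one_le_sqrt.2 (by exact_mod_cast hTpos)
    calc A + B ≤ ENNReal.ofReal 2 * (1 + lz) ^ (1 / 2 : ℝ) * (2 * K) ^ (1 / 2 : ℝ) := by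
          refine (add_le_add hA2 hB2).trans_eq ?_
          rw [ENNReal.ofReal_ofNat]
          ring
      _ ≤ _ := by
          gcongr
          linarith

/-- For a finite filtration and measures of finite relative entropy there is a coupling, causal in
both directions, for which the weighted cost of leaving the diagonal is controlled by the
entropy. -/
theorem exists_bicausal_lintegral_ne_le {E : Type*} {mE : MeasurableSpace E} [StandardBorelSpace E]
    {μ ν : Measure E} [IsProbabilityMeasure μ] [IsProbabilityMeasure ν] (hK : klDiv ν μ ≠ ∞)
    {F : ℕ → MeasurableSpace E} (hF : Monotone F) (hFle : ∀ t, F t ≤ mE) {T : ℕ} (hT : mE ≤ F T)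
    (hF0 : ∀ A, MeasurableSet[F 0] A → A = ∅ ∨ A = Set.univ) :
    ∃ π : Measure (E × E), π.map Prod.fst = μ ∧ π.map Prod.snd = ν ∧
      (∀ s ≤ T, ∀ B, MeasurableSet[F s] B → ∃ g : E → ℝ≥0∞, Measurable[F s] g ∧
        ∀ A, MeasurableSet A → π (A ×ˢ B) = ∫⁻ x in A, g x ∂μ) ∧
      (∀ s ≤ T, ∀ A, MeasurableSet[F s] A → ∃ g : E → ℝ≥0∞, Measurable[F s] g ∧
        ∀ B, MeasurableSet B → π (A ×ˢ B) = ∫⁻ y in B, g y ∂ν) ∧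
      ∀ φ : E → ℝ≥0, Measurable φ →
        ∫⁻ p, {p : E × E | p.1 ≠ p.2}.indicator (fun p => (φ p.1 : ℝ≥0∞) + φ p.2) p ∂π
          ≤ ENNReal.ofReal (2 * Real.sqrt T + 1)
            * (1 + (ENNReal.log
              (∫⁻ x, ENNReal.ofReal (Real.exp ((φ x : ℝ) ^ 2)) ∂μ)).toENNReal) ^ (1 / 2 : ℝ)
            * (2 * klDiv ν μ) ^ (1 / 2 : ℝ) := by
  have hac : ν ≪ μ := (klDiv_ne_top_iff.1 hK).1
  obtain ⟨ℓ, hℓ, hℓ0, hℓν⟩ : ∃ ℓ : ℕ → E → ℝ≥0, (∀ t, Measurable[F t] (ℓ t)) ∧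
      (∀ x, ℓ 0 x = 1) ∧ ∀ t A, MeasurableSet[F t] A → ν A = ∫⁻ x in A, ℓ t x ∂μ := by
    choose d hd hdν using fun t => exists_density_of_absolutelyContinuous (hFle t) hac
    -- The density at time zero must be one at every point, not just almost everywhere; as `F 0` is
    -- trivial, the constant is a valid choice.
    refine ⟨fun t => if t = 0 then 1 else d t, fun t => ?_, fun x => by simp, fun t A hA => ?_⟩
    · rcases eq_or_ne t 0 with rfl | ht
      · exact measurable_const
      · simpa only [if_neg ht] using hd t
    · rcases eq_or_ne t 0 with rfl | ht
      · rcases hF0 A hA with rfl | rfl <;> simp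
      · simpa only [if_neg ht] using hdν t A hA
  have hν : ∀ t (g : E → ℝ≥0∞), Measurable[F t] g → ∫⁻ x, g x ∂ν = ∫⁻ x, g x * ℓ t x ∂μ :=
    fun t g hg => lintegral_eq_lintegral_mul_density (hFle t) (hℓ t) (hℓν t) hg
  have hℓm : ∀ t, Measurable (ℓ t) := fun t => (hℓ t).mono (hFle t) le_rfl
  have hKeq : klDiv ν μ = ∫⁻ x, ENNReal.ofReal (klFun (ℓ T x)) ∂μ := by
    have hdens : ν = μ.withDensity fun x => (ℓ T x : ℝ≥0∞) := by
      ext A hA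
      rw [withDensity_apply _ hA, hℓν T A (hT A hA)]
    have hrn : ν.rnDeriv μ =ᵐ[μ] fun x => (ℓ T x : ℝ≥0∞) := by
      conv_lhs => rw [hdens]
      exact Measure.rnDeriv_withDensity μ (hℓm T).coe_nnreal_ennreal
    rw [klDiv_eq_lintegral_klFun_of_ac hac]
    refine lintegral_congr_ae ?_
    filter_upwards [hrn] with x hx
    rw [hx, ENNReal.coe_toReal]
  set v : ℕ → E → ℝ≥0 := fun t x => keptWeight (fun s => ℓ s x) t with hvdef
  have hv : ∀ t, Measurable[F t] (v t) := measurable_keptWeight hF hℓ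
  have huv : ∀ t A, MeasurableSet[F t] A →
      ∫⁻ x in A, (v t x * ℓ t x : ℝ≥0) ∂μ = ∫⁻ x in A, v t x ∂ν := by
    intro t A hA
    have hg : Measurable[F t] (A.indicator fun x => (v t x : ℝ≥0∞)) :=
      Measurable.indicator (hv t).coe_nnreal_ennreal hA
    rw [← lintegral_indicator (hFle t _ hA), ← lintegral_indicator (hFle t _ hA), hν t _ hg]
    refine lintegral_congr fun x => ?_
    by_cases hx : x ∈ A <;> simp [hx]
  obtain ⟨π, h1, h2, h3, h4, h5⟩ := exists_bicausal_splitCoupling hF hFle hT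
    (u := fun t x => v t x * ℓ t x) (v := v) (fun t => (hv t).mul (hℓ t)) hv
    (fun x => antitone_keptWeight_mul _) (fun x => antitone_keptWeight _)
    (fun x => by simp [hvdef, keptWeight, hℓ0]) (fun x => rfl) huv
  refine ⟨π, h1, h2, h3, h4, fun φ hφ => ?_⟩
  refine (h5 (fun x => φ x) hφ.coe_nnreal_ennreal).trans ?_
  have hvm : ∀ t, Measurable (v t) := fun t => (hv t).mono (hFle t) le_rfl
  have hum : Measurable fun x => ((1 - v T x * ℓ T x : ℝ≥0) : ℝ≥0∞) :=
    (((hvm T).mul (hℓm T)).const_sub 1).coe_nnreal_ennreal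
  have hwm : Measurable fun x => ((1 - v T x : ℝ≥0) : ℝ≥0∞) :=
    ((hvm T).const_sub 1).coe_nnreal_ennreal
  have hφm := hφ.coe_nnreal_ennreal
  rw [hKeq] at hK
  have hU := lintegral_sq_one_sub_keptWeight_mul_le hF hFle hℓ hℓ0 hν T hK
  have hV := lintegral_sq_one_sub_keptWeight_le hF hFle hℓ hν T hK
  rw [← hKeq] at hU hV
  have hle1 : ∀ (γ : Measure E) [IsProbabilityMeasure γ] (w : E → ℝ≥0),
      ∫⁻ x, ((1 - w x : ℝ≥0) : ℝ≥0∞) ^ 2 ∂γ ≤ 1 := by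
    intro γ _ w
    calc _ ≤ ∫⁻ _, (1 : ℝ≥0∞) ∂γ := lintegral_mono fun x =>
          pow_le_one₀ zero_le (ENNReal.coe_le_one_iff.2 tsub_le_self)
      _ = 1 := by simp
  have hφμ : ∫⁻ x, (φ x : ℝ≥0∞) ^ 2 ∂μ
      ≤ (ENNReal.log (∫⁻ x, ENNReal.ofReal (Real.exp ((φ x : ℝ) ^ 2)) ∂μ)).toENNReal := by
    -- With density one the entropy term vanishes and Gibbs' inequality becomes Jensen's.
    have := lintegral_sq_mul_le (μ := μ) (b := fun _ => 1) measurable_const (by simp) hφ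
    simpa [klFun_one] using this
  have hφν : ∫⁻ x, (φ x : ℝ≥0∞) ^ 2 ∂ν ≤ klDiv ν μ
      + (ENNReal.log (∫⁻ x, ENNReal.ofReal (Real.exp ((φ x : ℝ) ^ 2)) ∂μ)).toENNReal := by
    rw [hKeq, hν T _ ((hφm.pow_const 2).mono hT le_rfl)]
    refine lintegral_sq_mul_le (hℓm T) ?_ hφ
    have := hν T (fun _ => 1) measurable_const
    simpa using this.symm
  refine add_le_mul_sqrt_entropy
    (lintegral_mul_le_sqrt_mul_sqrt hφm hum hφμ hU)
    (lintegral_mul_le_sqrt_mul_sqrt hφm hwm hφν hV) ?_ ?_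
  · simpa using lintegral_mul_le_sqrt_mul_sqrt hφm hum hφμ (hle1 μ _)
  · simpa using lintegral_mul_le_sqrt_mul_sqrt hφm hwm hφν (hle1 ν _)

/-! ### The coordinate filtration on path space -/

section Path

universe u

variable {T : ℕ} {X : Fin T → Type u} [∀ i, MeasurableSpace (X i)]

/-- The `σ`-algebra on path space generated by the first `t` coordinates. -/
abbrev pathFiltration (X : Fin T → Type u) [∀ i, MeasurableSpace (X i)] (t : ℕ) :
    MeasurableSpace (∀ i, X i) :=
  MeasurableSpace.comap (initSegment (X := X) t) inferInstance

lemma pathFiltration_le (t : ℕ) : pathFiltration X t ≤ MeasurableSpace.pi :=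
  (measurable_initSegment t).comap_le

lemma measurable_eval_pathFiltration {t : ℕ} (i : Fin T) (hi : (i : ℕ) < t) :
    Measurable[pathFiltration X t] fun x : ∀ i, X i => x i :=
  (measurable_pi_apply (⟨i, hi⟩ : {i : Fin T // (i : ℕ) < t})).comp
    (comap_measurable (initSegment (X := X) t))

lemma monotone_pathFiltration : Monotone (pathFiltration X) := by
  intro s t hst
  rw [pathFiltration, ← measurable_iff_comap_le]
  exact @measurable_pi_lambda _ _ _ (pathFiltration X t) _ _ fun i =>
    measurable_eval_pathFiltration i.1 (i.2.trans_le hst)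

lemma pi_le_pathFiltration : MeasurableSpace.pi ≤ pathFiltration X T :=
  iSup_le fun i => (measurable_eval_pathFiltration i i.2).comap_le

lemma eq_empty_or_univ_of_pathFiltration_zero {A : Set (∀ i, X i)}
    (hA : MeasurableSet[pathFiltration X 0] A) : A = ∅ ∨ A = Set.univ := by
  obtain ⟨S, -, rfl⟩ := hA
  have : Subsingleton (∀ i : {i : Fin T // (i : ℕ) < 0}, X i) :=
    ⟨fun f g => funext fun i => absurd i.2 (Nat.not_lt_zero _)⟩
  rcases S.eq_empty_or_nonempty with rfl | ⟨s, hs⟩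
  · exact Or.inl rfl
  · refine Or.inr (Set.eq_univ_of_forall fun x => ?_)
    rwa [Set.mem_preimage, Subsingleton.elim (initSegment 0 x) s]

lemma isBicausalCoupling_of_exists_density [∀ i, StandardBorelSpace (X i)]
    {μ ν : Measure (∀ i, X i)} {π : Measure ((∀ i, X i) × (∀ i, X i))} [IsProbabilityMeasure π]
    (h1 : π.map Prod.fst = μ) (h2 : π.map Prod.snd = ν)
    (h3 : ∀ s ≤ T, ∀ B, MeasurableSet[pathFiltration X s] B → ∃ g : (∀ i, X i) → ℝ≥0∞,
      Measurable[pathFiltration X s] g ∧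
        ∀ A, MeasurableSet A → π (A ×ˢ B) = ∫⁻ x in A, g x ∂μ)
    (h4 : ∀ s ≤ T, ∀ A, MeasurableSet[pathFiltration X s] A → ∃ g : (∀ i, X i) → ℝ≥0∞,
      Measurable[pathFiltration X s] g ∧
        ∀ B, MeasurableSet B → π (A ×ˢ B) = ∫⁻ y in B, g y ∂ν) :
    IsBicausalCoupling π μ ν := by
  refine ⟨h1, h2, fun t _ ht => ?_, fun t _ ht => ?_⟩
  · refine condIndepFun_of_forall_exists_density measurable_fst measurable_snd
      (measurable_initSegment t) fun B hB => ?_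
    obtain ⟨g, hg, hgA⟩ := h3 t ht.le _ ⟨B, hB, rfl⟩
    -- By Doob–Dynkin, a density measurable for the first `t` coordinates is a function of them.
    obtain ⟨g', hg', rfl⟩ := hg.exists_eq_measurable_comp
    refine ⟨g', hg', fun A hA => ?_⟩
    rw [← Set.prod_eq, hgA A hA, ← h1,
      setLIntegral_map hA (hg.mono (pathFiltration_le t) le_rfl) measurable_fst]
    rfl
  · refine condIndepFun_of_forall_exists_density measurable_snd measurable_fst
      (measurable_initSegment t) fun B hB => ?_
    obtain ⟨g, hg, hgA⟩ := h4 t ht.le _ ⟨B, hB, rfl⟩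
    obtain ⟨g', hg', rfl⟩ := hg.exists_eq_measurable_comp
    refine ⟨g', hg', fun A hA => ?_⟩
    rw [Set.inter_comm, ← Set.prod_eq, hgA A hA, ← h2,
      setLIntegral_map hA (hg.mono (pathFiltration_le t) le_rfl) measurable_snd]
    rfl

end Path

end AdaptedTransport

/-- All quantities live in `[0, ∞]`, with `0 * ∞ = 0`. The argument of the logarithm is at least `1`,
so `1 + log ∫ exp (φ ^ 2) dμ` is an element of `[1, ∞]`, and `toENNReal` only changes its type.
`klDiv ν μ` is the relative entropy `H(ν | μ)`. -/
theorem theorem1p4 {T : ℕ} {X : Fin T → Type*}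
    [∀ i, TopologicalSpace (X i)] [∀ i, PolishSpace (X i)]
    [∀ i, MeasurableSpace (X i)] [∀ i, BorelSpace (X i)]
    (μ ν : Measure (∀ i, X i)) [IsProbabilityMeasure μ] [IsProbabilityMeasure ν]
    (φ : (∀ i, X i) → ℝ≥0) (hφ : Measurable φ) :
    AdaptedTransport.adaptedTV φ μ ν ≤
      ENNReal.ofReal (2 * Real.sqrt T + 1)
        * ((1 + ENNReal.log
            (∫⁻ x, ENNReal.ofReal (Real.exp ((φ x : ℝ) ^ 2)) ∂μ)).toENNReal) ^ (1 / 2 : ℝ)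
        * (2 * klDiv ν μ) ^ (1 / 2 : ℝ) := by
  have hZ : (1 : ℝ≥0∞) ≤ ∫⁻ x, ENNReal.ofReal (Real.exp ((φ x : ℝ) ^ 2)) ∂μ := by
    calc (1 : ℝ≥0∞) = ∫⁻ _, 1 ∂μ := by simp
      _ ≤ _ := lintegral_mono fun x => by
        rw [ENNReal.one_le_ofReal]
        exact Real.one_le_exp (by positivity)
  rw [EReal.toENNReal_add zero_le_one (ENNReal.zero_le_log_iff.2 hZ),
    show EReal.toENNReal 1 = 1 by
      exact_mod_cast EReal.toENNReal_coe (x := 1)]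
  -- With infinite entropy the right side is infinite, because the other two factors are nonzero.
  by_cases hK : klDiv ν μ = ∞
  · have h1 : ENNReal.ofReal (2 * Real.sqrt T + 1) ≠ 0 := by
      rw [Ne, ENNReal.ofReal_eq_zero, not_le]
      positivity
    have h2 : (1 + (ENNReal.log (∫⁻ x, ENNReal.ofReal
        (Real.exp ((φ x : ℝ) ^ 2)) ∂μ)).toENNReal) ^ (1 / 2 : ℝ) ≠ 0 := by
      simp
    rw [hK, ENNReal.mul_top two_ne_zero, ENNReal.top_rpow_of_pos (by norm_num),
      ENNReal.mul_top (mul_ne_zero h1 h2)]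
    exact le_top
  · obtain ⟨π, h1, h2, h3, h4, h5⟩ := AdaptedTransport.exists_bicausal_lintegral_ne_le hK
      AdaptedTransport.monotone_pathFiltration AdaptedTransport.pathFiltration_le
      AdaptedTransport.pi_le_pathFiltration
      fun A hA => AdaptedTransport.eq_empty_or_univ_of_pathFiltration_zero hA
    have hπ : IsProbabilityMeasure π := by
      have : IsProbabilityMeasure (π.map Prod.fst) := h1 ▸ inferInstance
      exact Measure.isProbabilityMeasure_of_map Prod.fst
    refine (iInf₂_le (⟨π, hπ⟩ : ProbabilityMeasure _)
      (AdaptedTransport.isBicausalCoupling_of_exists_density h1 h2 h3 h4)).trans ?_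
    exact h5 φ hφ
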